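/- Let $L, M$ be full-rank lattices in $\mathbb{R}^d$ (discrete subgroups of $\mathbb{R}^d$ that span $\mathbb{R}^d$ over $\mathbb{R}$) with $\mathrm{vol}(L) < \mathrm{vol}(M)$, where $\mathrm{vol}$ denotes the Lebesgue measure of a fundamental parallelepiped of the lattice. Then there is a bounded measurable set $F \subseteq \mathbb{R}^d$, which can be taken to be a finite union of polytopes (a polytope being the convex hull of a finite set of points), such that $F$ tiles $\mathbb{R}^d$ by translations with $L$ and packs $\mathbb{R}^d$ by translations with $M$; that is, $$\sum_{t \in L} \mathbf{1}_F(x+t) = 1 \quad\text{and}\quad \sum_{t \in M} \mathbf{1}_F(x+t) \le 1 \qquad \text{for almost every } x \in \mathbb{R}^d.$$ -/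

import Mathlib

open scoped ENNReal
open MeasureTheory

/-- `Ω` packs the space by translations by `A`: `∑_{t ∈ A} 1_Ω(x + t) ≤ 1` for almost every `x`.
The sum is taken in `[0, ∞]`, where it always exists. -/
def PacksBy {E : Type*} [AddCommGroup E] [MeasureSpace E] (Ω A : Set E) : Prop :=
  ∀ᵐ x : E, ∑' t : A, Ω.indicator (fun _ => (1 : ℝ≥0∞)) (x + (t : E)) ≤ 1

/-- `Ω` tiles the space by translations by `A`: `∑_{t ∈ A} 1_Ω(x + t) = 1` for almost every `x`. -/
def TilesBy {E : Type*} [AddCommGroup E] [MeasureSpace E] (Ω A : Set E) : Prop :=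
  ∀ᵐ x : E, ∑' t : A, Ω.indicator (fun _ => (1 : ℝ≥0∞)) (x + (t : E)) = 1

/-- A polytope is the convex hull of a finite set of points. -/
def IsPolytope {E : Type*} [AddCommGroup E] [Module ℝ E] (P : Set E) : Prop :=
  ∃ V : Set E, V.Finite ∧ P = convexHull ℝ V

/-- `F` is the union of finitely many polytopes. -/
def IsFiniteUnionOfPolytopes {E : Type*} [AddCommGroup E] [Module ℝ E] (F : Set E) : Prop :=
  ∃ S : Set (Set E), S.Finite ∧ (∀ P ∈ S, IsPolytope P) ∧ F = ⋃₀ S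

/-! Suppose first that `L + M` is dense. Let `A` and `B` be fundamental domains of `L` and `M`. As
`vol A < vol B`, the cubes of a fine grid that meet `A` are at most as many as the slightly larger
cubes inside `B`, so they can be assigned injectively. By density, some `l + m` moves each small
cube into its larger one. Let `F` be the union of the pieces of `A`, each moved by its `l` only.
Then `F` is a rearrangement of `A` by vectors of `L`, so it tiles with `L`; the remaining moves by
`m` carry `F` injectively into `B`, so it packs with `M`.

In general the closure of `L + M` is, in linear coordinates, the group of vectors whose coordinates
in a set `J` are integers (`exists_basis_mem_iff_int_coords`). Cells then keep side `1` in the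
directions of `J`, and `A`, `B` are replaced by their preimages under `floorOn J`. These are still
fundamental domains, and within a cell they do not depend on the `J`-coordinates, so refining the
other directions suffices. `exists_injOn_gridCell` counts, `exists_add_mem_gridCell` moves, and
`exists_halfOpenPolyhedra` assembles. Half-open pieces keep this exact; closing them at the end
changes only a null set. -/

/-- A half-open polyhedron: the solutions of finitely many conditions `a i ≤ f i x < b i` with
linear functionals `f i`. -/
def IsHalfOpenPolyhedron {E : Type*} [AddCommGroup E] [Module ℝ E] (p : Set E) : Prop :=
  ∃ (κ : Type) (_ : Finite κ) (f : κ → E →ₗ[ℝ] ℝ) (a b : κ → ℝ),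
    p = {x | ∀ i, f i x ∈ Set.Ico (a i) (b i)}

/-! ### Polyhedra, polytopes and null boundaries -/

section Polytopes

variable {E : Type*} [NormedAddCommGroup E] [NormedSpace ℝ E]

/-- A polyhedron has finitely many extreme points. -/
theorem finite_extremePoints_polyhedron {κ : Type*} [Finite κ] (f : κ → E →ₗ[ℝ] ℝ) (a b : κ → ℝ) :
    (Set.extremePoints ℝ {x | ∀ i, f i x ∈ Set.Icc (a i) (b i)}).Finite := by
  cases nonempty_fintype κ
  set K : Set E := {x | ∀ i, f i x ∈ Set.Icc (a i) (b i)} with hK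
  -- An extreme point is determined by its tight constraints: if `x` and `y` share them, small moves
  -- of `x` along `±(x - y)` stay in `K`.
  let act : E → Set κ × Set κ := fun x => ({i | f i x = a i}, {i | f i x = b i})
  refine Set.Finite.of_finite_image (f := act) (Set.toFinite _) ?_
  intro x hx y hy hxy
  by_contra hne
  have hxK : ∀ i, f i x ∈ Set.Icc (a i) (b i) := hx.1
  have hyK : ∀ i, f i y ∈ Set.Icc (a i) (b i) := hy.1
  have ha : ∀ i, f i x = a i → f i y = a i := fun i hi => by
    have := congrArg Prod.fst hxy
    exact (Set.ext_iff.1 this i).1 hi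
  have hb : ∀ i, f i x = b i → f i y = b i := fun i hi => by
    have := congrArg Prod.snd hxy
    exact (Set.ext_iff.1 this i).1 hi
  have key : ∀ s : ℝ, ∀ᶠ t in nhdsWithin (0 : ℝ) (Set.Ioi 0),
      x + (s * t) • (x - y) ∈ K := by
    intro s
    simp only [hK, Set.mem_ofPred_eq, Filter.eventually_all]
    intro i
    have hcont : Filter.Tendsto (fun t : ℝ => f i (x + (s * t) • (x - y)))
        (nhdsWithin 0 (Set.Ioi 0)) (nhds (f i x)) := by
      have : Continuous fun t : ℝ => f i x + (s * t) * f i (x - y) := by fun_prop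
      have h0 := this.tendsto 0
      simp only [mul_zero, zero_mul, add_zero] at h0
      refine (h0.mono_left nhdsWithin_le_nhds).congr fun t => ?_
      simp
    have h1 : ∀ᶠ t in nhdsWithin (0 : ℝ) (Set.Ioi 0), a i ≤ f i (x + (s * t) • (x - y)) := by
      rcases (hxK i).1.eq_or_lt with h | h
      · refine Filter.Eventually.of_forall fun t => ?_
        simp [ha i h.symm, ← h]
      · exact (hcont.eventually (lt_mem_nhds h)).mono fun t ht => ht.le
    have h2 : ∀ᶠ t in nhdsWithin (0 : ℝ) (Set.Ioi 0), f i (x + (s * t) • (x - y)) ≤ b i := by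
      rcases (hxK i).2.eq_or_lt with h | h
      · refine Filter.Eventually.of_forall fun t => ?_
        simp [hb i h, h]
      · exact (hcont.eventually (gt_mem_nhds h)).mono fun t ht => ht.le
    exact h1.and h2
  obtain ⟨t, ⟨h1, h2⟩, ht : 0 < t⟩ :=
    (((key 1).and (key (-1))).and self_mem_nhdsWithin).exists
  have hseg : x ∈ openSegment ℝ (x + (1 * t) • (x - y)) (x + (-1 * t) • (x - y)) := by
    refine ⟨1 / 2, 1 / 2, by norm_num, by norm_num, by norm_num, ?_⟩
    module
  have := hx.2 h1 h2 hseg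
  have h3 : t • (x - y) = 0 := by simpa using this
  rcases smul_eq_zero.1 h3 with h | h
  · exact ht.ne' h
  · exact hne (sub_eq_zero.1 h)

theorem isClosed_polyhedron [FiniteDimensional ℝ E] {κ : Type*} (f : κ → E →ₗ[ℝ] ℝ) (a b : κ → ℝ) :
    IsClosed {x | ∀ i, f i x ∈ Set.Icc (a i) (b i)} := by
  simp only [Set.ofPred_forall]
  exact isClosed_iInter fun i => isClosed_Icc.preimage (f i).continuous_of_finiteDimensional

theorem convex_polyhedron {κ : Type*} (f : κ → E →ₗ[ℝ] ℝ) (a b : κ → ℝ) :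
    Convex ℝ {x | ∀ i, f i x ∈ Set.Icc (a i) (b i)} := by
  simp only [Set.ofPred_forall]
  exact convex_iInter fun i => (convex_Icc _ _).linear_preimage (f i)

/-- A bounded polyhedron is a polytope. -/
theorem isPolytope_of_isBounded_polyhedron [FiniteDimensional ℝ E] {κ : Type*} [Finite κ]
    (f : κ → E →ₗ[ℝ] ℝ) (a b : κ → ℝ)
    (hbd : Bornology.IsBounded {x | ∀ i, f i x ∈ Set.Icc (a i) (b i)}) :
    IsPolytope {x | ∀ i, f i x ∈ Set.Icc (a i) (b i)} := by
  have hfin := finite_extremePoints_polyhedron f a b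
  have : ProperSpace E := FiniteDimensional.proper ℝ E
  refine ⟨_, hfin, ?_⟩
  -- Krein–Milman yields the closed convex hull; the hull of a finite set is already closed.
  rw [← (hfin.isCompact_convexHull ℝ).isClosed.closure_eq]
  exact (closure_convexHull_extremePoints
    (Metric.isCompact_of_isClosed_isBounded (isClosed_polyhedron f a b) hbd)
    (convex_polyhedron f a b)).symm

namespace IsHalfOpenPolyhedron

theorem convex {p : Set E} (hp : IsHalfOpenPolyhedron p) : Convex ℝ p := by
  obtain ⟨κ, _, f, a, b, rfl⟩ := hp
  simp only [Set.ofPred_forall]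
  exact convex_iInter fun i => (convex_Ico _ _).linear_preimage (f i)

/-- The closure of a bounded half-open polyhedron is a polytope. -/
theorem isPolytope_closure [FiniteDimensional ℝ E] {p : Set E} (hp : IsHalfOpenPolyhedron p)
    (hbd : Bornology.IsBounded p) : IsPolytope (closure p) := by
  obtain ⟨κ, _, f, a, b, rfl⟩ := hp
  rcases Set.eq_empty_or_nonempty {x | ∀ i, f i x ∈ Set.Ico (a i) (b i)} with h | ⟨y, hy⟩
  · rw [h]
    exact ⟨∅, Set.finite_empty, by simp⟩
  · have hcl : closure {x | ∀ i, f i x ∈ Set.Ico (a i) (b i)} =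
        {x | ∀ i, f i x ∈ Set.Icc (a i) (b i)} := by
      refine (closure_minimal (fun x (hx : ∀ i, _) i => Set.Ico_subset_Icc_self (hx i))
        (isClosed_polyhedron f a b)).antisymm fun x hx => ?_
      -- Any step from `x` towards `y` makes all upper bounds strict.
      have hlim : Filter.Tendsto (fun t : ℝ => x + t • (y - x)) (nhdsWithin 0 (Set.Ioi 0))
          (nhds x) := by
        have : Continuous fun t : ℝ => x + t • (y - x) := by fun_prop
        simpa using (this.tendsto 0).mono_left nhdsWithin_le_nhds
      refine mem_closure_of_tendsto hlim ?_
      filter_upwards [Ioo_mem_nhdsGT (zero_lt_one (α := ℝ))] with t ht i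
      have h1 := hx i
      have h2 := hy i
      simp only [Set.mem_Icc, Set.mem_Ico, map_add, map_smul, map_sub, smul_eq_mul] at h1 h2 ⊢
      constructor <;> nlinarith [ht.1, ht.2]
    rw [hcl]
    exact isPolytope_of_isBounded_polyhedron f a b (hcl ▸ hbd.closure)

/-- A half-open polyhedron agrees with its closure up to a null set. -/
theorem closure_ae_eq [FiniteDimensional ℝ E] [MeasurableSpace E] [BorelSpace E]
    (μ : Measure E) [μ.IsAddHaarMeasure] {p : Set E} (hp : IsHalfOpenPolyhedron p) : closure p =ᵐ[μ] p := by
  have h := hp.convex.addHaar_frontier μ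
  refine ae_eq_set.2 ⟨measure_mono_null (t := frontier p)
    (fun x hx => ⟨hx.1, fun h => hx.2 (interior_subset h)⟩) h, ?_⟩
  rw [Set.sdiff_eq_empty.2 subset_closure, measure_empty]

theorem preimage {E' : Type*} [AddCommGroup E'] [Module ℝ E'] {p : Set E}
    (hp : IsHalfOpenPolyhedron p) (e : E' →ₗ[ℝ] E) : IsHalfOpenPolyhedron (e ⁻¹' p) := by
  obtain ⟨κ, hκ, f, a, b, rfl⟩ := hp
  exact ⟨κ, hκ, fun i => (f i).comp e, a, b, rfl⟩

theorem preimage_sub {p : Set E} (hp : IsHalfOpenPolyhedron p) (v : E) :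
    IsHalfOpenPolyhedron ((fun x => x - v) ⁻¹' p) := by
  obtain ⟨κ, hκ, f, a, b, rfl⟩ := hp
  refine ⟨κ, hκ, f, fun i => a i + f i v, fun i => b i + f i v, ?_⟩
  ext x
  simp only [Set.mem_preimage, Set.mem_ofPred_eq, map_sub, Set.mem_Ico]
  exact forall_congr' fun i => and_congr le_sub_iff_add_le sub_lt_iff_lt_add

end IsHalfOpenPolyhedron

/-- Replacing half-open polyhedra by their closures turns an exact tiling and packing into an almost
everywhere tiling and packing by a finite union of polytopes. -/
theorem exists_polytopes_of_halfOpenPolyhedra {d : ℕ} (L M : Set (EuclideanSpace ℝ (Fin d)))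
    [Countable L] [Countable M] (S : Set (Set (EuclideanSpace ℝ (Fin d)))) (hS : S.Finite)
    (hpoly : ∀ p ∈ S, IsHalfOpenPolyhedron p) (hbd : ∀ p ∈ S, Bornology.IsBounded p)
    (htile : ∀ x : EuclideanSpace ℝ (Fin d), ∃! t : L, x + t ∈ ⋃₀ S)
    (hpack : ∀ x : EuclideanSpace ℝ (Fin d), ∀ t t' : M, x + t ∈ ⋃₀ S → x + t' ∈ ⋃₀ S → t = t') :
    ∃ F : Set (EuclideanSpace ℝ (Fin d)),
      Bornology.IsBounded F ∧ MeasurableSet F ∧ IsFiniteUnionOfPolytopes F ∧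
        TilesBy F L ∧ PacksBy F M := by
  set F : Set (EuclideanSpace ℝ (Fin d)) := ⋃₀ (closure '' S) with hF
  have hFS : F =ᵐ[volume] ⋃₀ S := by
    rw [hF, Set.sUnion_image, Set.sUnion_eq_biUnion]
    exact Filter.EventuallyEq.countable_bUnion hS.countable
      fun p hp => (hpoly p hp).closure_ae_eq volume
  have htrans : ∀ A : Set (EuclideanSpace ℝ (Fin d)), Countable A →
      ∀ᵐ x : EuclideanSpace ℝ (Fin d), ∀ t : A, F.indicator (fun _ => (1 : ℝ≥0∞)) (x + t) =
        (⋃₀ S).indicator (fun _ => (1 : ℝ≥0∞)) (x + t) := by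
    intro A _
    rw [ae_all_iff]
    intro t
    have hq := (measurePreserving_add_right (volume : Measure (EuclideanSpace ℝ (Fin d)))
      (t : EuclideanSpace ℝ (Fin d))).quasiMeasurePreserving.ae hFS
    filter_upwards [hq] with x hx
    have hx' : (x + t ∈ F) = (x + t ∈ ⋃₀ S) := hx
    classical
    simp only [Set.indicator_apply, hx']
  refine ⟨F, ?_, ?_, ⟨closure '' S, hS.image _, ?_, rfl⟩, ?_, ?_⟩
  · rw [hF, Bornology.isBounded_sUnion (hS.image _)]
    rintro _ ⟨p, hp, rfl⟩
    exact (hbd p hp).closure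
  · refine MeasurableSet.sUnion (hS.image _).countable ?_
    rintro _ ⟨p, -, rfl⟩
    exact isClosed_closure.measurableSet
  · rintro _ ⟨p, hp, rfl⟩
    exact (hpoly p hp).isPolytope_closure (hbd p hp)
  · filter_upwards [htrans L inferInstance] with x hx
    simp only [hx]
    obtain ⟨t, ht, huniq⟩ := htile x
    rw [tsum_eq_single t, Set.indicator_of_mem ht]
    intro t' ht'
    exact Set.indicator_of_notMem (fun h => ht' (huniq t' h)) _
  · filter_upwards [htrans M inferInstance] with x hx
    simp only [hx]
    by_cases h : ∃ t : M, x + t ∈ ⋃₀ S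
    · obtain ⟨t, ht⟩ := h
      rw [tsum_eq_single t, Set.indicator_of_mem ht]
      intro t' ht'
      exact Set.indicator_of_notMem (fun h => ht' (hpack x t' t h ht)) _
    · push Not at h
      simp [Set.indicator_of_notMem (h _)]

end Polytopes

/-! ### Structure of closed subgroups that span -/

section ClosedSubgroups

variable {E : Type*} [NormedAddCommGroup E]

/-- The set of vectors that span a line contained in a given additive subgroup. -/
def lineSubspace [NormedSpace ℝ E] (H : AddSubgroup E) : Submodule ℝ E where
  carrier := {v | ∀ t : ℝ, t • v ∈ H}
  zero_mem' t := by simp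
  add_mem' hx hy t := by
    rw [smul_add]
    exact H.add_mem (hx t) (hy t)
  smul_mem' c x hx t := by
    rw [smul_smul]
    exact hx (t * c)

theorem mem_of_mem_lineSubspace [NormedSpace ℝ E] {H : AddSubgroup E} {v : E}
    (hv : v ∈ lineSubspace H) : v ∈ H := by
  simpa using hv 1

/-- A closed subgroup with arbitrarily short nonzero vectors in a closed subspace contains a line
of this subspace. -/
theorem exists_mem_lineSubspace [NormedSpace ℝ E] [FiniteDimensional ℝ E] {H : AddSubgroup E}
    (hH : IsClosed (H : Set E)) (W : Submodule ℝ E)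
    (hshort : ∀ ε > 0, ∃ h ∈ H, h ∈ W ∧ h ≠ 0 ∧ ‖h‖ < ε) :
    ∃ u ∈ lineSubspace H, u ∈ W ∧ u ≠ 0 := by
  have : ProperSpace E := FiniteDimensional.proper ℝ E
  choose h hhH hhW hh0 hhε using fun n : ℕ => hshort (1 / ((n : ℝ) + 1)) (by positivity)
  have hnorm : ∀ n, ‖(‖h n‖⁻¹ : ℝ) • h n‖ = 1 := fun n => by
    rw [norm_smul, norm_inv, norm_norm, inv_mul_cancel₀ (norm_ne_zero_iff.2 (hh0 n))]
  obtain ⟨u, hu, φ, hφ, hlim⟩ := (isCompact_sphere (0 : E) 1).tendsto_subseq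
    (x := fun n => (‖h n‖⁻¹ : ℝ) • h n) (fun n => by simpa using hnorm n)
  have hh : Filter.Tendsto (fun n => ‖h (φ n)‖) Filter.atTop (nhds 0) :=
    squeeze_zero (fun n => norm_nonneg _) (fun n => (hhε _).le)
      (tendsto_one_div_add_atTop_nhds_zero_nat.comp hφ.tendsto_atTop)
  refine ⟨u, fun t => ?_, ?_, ?_⟩
  -- Integer multiples of a short `h` come within `‖h‖` of every point of its line, so the limit
  -- line lies in `H`.
  · have hmain : Filter.Tendsto (fun n => ⌊t * ‖h (φ n)‖⁻¹⌋ • h (φ n)) Filter.atTop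
        (nhds (t • u)) := by
      have hdiff : Filter.Tendsto
          (fun n => t • ((‖h (φ n)‖⁻¹ : ℝ) • h (φ n)) - ⌊t * ‖h (φ n)‖⁻¹⌋ • h (φ n))
          Filter.atTop (nhds 0) := by
        refine squeeze_zero_norm (fun n => ?_) hh
        rw [smul_smul, ← Int.cast_smul_eq_zsmul ℝ, ← sub_smul, norm_smul]
        refine mul_le_of_le_one_left (norm_nonneg _) ?_
        rw [Int.self_sub_floor, Real.norm_eq_abs, abs_of_nonneg (Int.fract_nonneg _)]
        exact (Int.fract_lt_one _).le
      simpa using (hlim.const_smul t).sub hdiff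
    exact hH.mem_of_tendsto hmain (Filter.Eventually.of_forall fun n => H.zsmul_mem (hhH _) _)
  · exact W.closed_of_finiteDimensional.mem_of_tendsto hlim
      (Filter.Eventually.of_forall fun n => W.smul_mem _ (hhW _))
  · rintro rfl
    simp at hu

variable [InnerProductSpace ℝ E] [FiniteDimensional ℝ E]

/-- A closed subgroup that spans is, in suitable linear coordinates, the set of vectors whose
coordinates in a given index set are integers. -/
theorem exists_basis_mem_iff_int_coords (H : AddSubgroup E) (hH : IsClosed (H : Set E))
    (hspan : Submodule.span ℝ (H : Set E) = ⊤) :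
    ∃ (ι : Type) (_ : Fintype ι) (J : Set ι) (b : Module.Basis ι ℝ E),
      ∀ x, x ∈ H ↔ ∀ j ∈ J, ∃ z : ℤ, b.repr x j = z := by
  set V := lineSubspace H with hV
  let Λ : Submodule ℤ Vᗮ :=
    (AddSubgroup.toIntSubmodule H).comap (Vᗮ.subtype.restrictScalars ℤ)
  have hmem : ∀ w : Vᗮ, w ∈ Λ ↔ (w : E) ∈ H := fun w => Iff.rfl
  -- Short nonzero vectors in `H ∩ Vᗮ` would produce a line of `H` inside `Vᗮ`, but all such lines
  -- lie in `V`.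
  have hdisc : DiscreteTopology Λ := by
    apply discreteTopology_of_isOpen_singleton_zero
    rw [Metric.isOpen_singleton_iff]
    by_contra hcon
    push Not at hcon
    obtain ⟨u, huV, huW, hu0⟩ := exists_mem_lineSubspace hH Vᗮ fun ε hε => by
      obtain ⟨y, hy, hy0⟩ := hcon ε hε
      refine ⟨((y : Vᗮ) : E), y.2, (y : Vᗮ).2, fun h => hy0 ?_, ?_⟩
      · exact Subtype.ext (Subtype.ext h)
      · simpa [dist_zero_right] using hy
    exact hu0 ((Submodule.disjoint_def.1 V.orthogonal_disjoint) u huV huW)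
  have hc : IsCompl V Vᗮ := V.isCompl_orthogonal
  let e := V.prodEquivOfIsCompl Vᗮ hc
  have hdecomp : ∀ x : E, x = (e.symm x).1 + (e.symm x).2 := fun x =>
    (e.apply_symm_apply x).symm
  -- Since `V ⊆ H`, only the component in `Vᗮ` decides membership.
  have hproj : ∀ x : E, x ∈ H ↔ (e.symm x).2 ∈ Λ := fun x => by
    rw [hmem]
    conv_lhs => rw [hdecomp x]
    exact H.add_mem_cancel_left (mem_of_mem_lineSubspace (e.symm x).1.2)
  have hlat : IsZLattice ℝ Λ := ⟨by
    let P : E →ₗ[ℝ] Vᗮ := (LinearMap.snd ℝ V Vᗮ).comp e.symm.toLinearMap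
    have hP : LinearMap.range P = ⊤ := by
      rw [LinearMap.range_eq_top]
      exact Prod.snd_surjective.comp e.symm.surjective
    rw [eq_top_iff, ← hP, ← Submodule.map_top, ← hspan, Submodule.map_span]
    refine Submodule.span_mono ?_
    rintro _ ⟨x, hx, rfl⟩
    exact (hproj x).1 hx⟩
  let bΛ := Module.finBasis ℤ Λ
  let bV := Module.finBasis ℝ V
  refine ⟨_, inferInstance, Set.range Sum.inr,
    (bV.prod (bΛ.ofZLatticeBasis ℝ)).map e, fun x => ?_⟩
  rw [hproj]
  conv_lhs => rw [← bΛ.ofZLatticeBasis_span ℝ]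
  rw [Module.Basis.mem_span_iff_repr_mem]
  simp only [Set.forall_mem_range, Module.Basis.map_repr, LinearEquiv.trans_apply,
    Module.Basis.prod_repr_inr]
  exact forall_congr' fun i => ⟨fun ⟨z, hz⟩ => ⟨z, hz.symm⟩, fun ⟨z, hz⟩ => ⟨z, hz.symm⟩⟩

end ClosedSubgroups

/-! ### Grids and rounding in the directions of `J` -/

section Grid

variable {ι : Type*} (J : Set ι)

open Classical in
/-- The side lengths of the cells of a grid: `1` in the directions of `J`, and `ε` in the others. -/
noncomputable def gridSide (ε : ℝ) (i : ι) : ℝ := if i ∈ J then 1 else ε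

/-- The index of the grid cell that contains a given point. -/
noncomputable def gridIndex (ε : ℝ) (x : ι → ℝ) (i : ι) : ℤ := ⌊x i / gridSide J ε i⌋

/-- The half-open box with a given index in the grid with side lengths `gridSide J ε`. -/
def gridCell (ε : ℝ) (n : ι → ℤ) : Set (ι → ℝ) := gridIndex J ε ⁻¹' {n}

open Classical in
/-- Rounding down of the coordinates in `J`. -/
noncomputable def floorOn (x : ι → ℝ) (i : ι) : ℝ := if i ∈ J then (⌊x i⌋ : ℝ) else x i

variable {J}

theorem gridSide_of_mem {ε : ℝ} {i : ι} (hi : i ∈ J) : gridSide J ε i = 1 := if_pos hi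

theorem gridSide_of_notMem {ε : ℝ} {i : ι} (hi : i ∉ J) : gridSide J ε i = ε := if_neg hi

theorem floorOn_of_mem {x : ι → ℝ} {i : ι} (hi : i ∈ J) : floorOn J x i = ⌊x i⌋ := if_pos hi

theorem floorOn_of_notMem {x : ι → ℝ} {i : ι} (hi : i ∉ J) : floorOn J x i = x i := if_neg hi

theorem gridSide_pos {ε : ℝ} (hε : 0 < ε) (i : ι) : 0 < gridSide J ε i := by
  unfold gridSide
  split_ifs <;> positivity

theorem gridSide_mul (s ε : ℝ) (i : ι) : gridSide J (s * ε) i = gridSide J s i * gridSide J ε i := by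
  unfold gridSide
  split_ifs <;> simp

theorem mem_gridCell_iff {ε : ℝ} (hε : 0 < ε) {n : ι → ℤ} {x : ι → ℝ} :
    x ∈ gridCell J ε n ↔
      ∀ i, x i ∈ Set.Ico (n i * gridSide J ε i) ((n i + 1) * gridSide J ε i) := by
  simp only [gridCell, Set.mem_preimage, Set.mem_singleton_iff, funext_iff, gridIndex,
    Int.floor_eq_iff, le_div_iff₀ (gridSide_pos hε _), div_lt_iff₀ (gridSide_pos hε _),
    Set.mem_Ico]

theorem gridCell_eq_pi {ε : ℝ} (hε : 0 < ε) (n : ι → ℤ) :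
    gridCell J ε n =
      Set.univ.pi fun i => Set.Ico (n i * gridSide J ε i) ((n i + 1) * gridSide J ε i) := by
  ext x
  simp [mem_gridCell_iff hε]

theorem floor_eq_of_mem_gridCell {ε : ℝ} {n : ι → ℤ} {x : ι → ℝ} (hx : x ∈ gridCell J ε n)
    {i : ι} (hi : i ∈ J) : ⌊x i⌋ = n i := by
  have : gridIndex J ε x i = n i := congrFun hx i
  simpa [gridIndex, gridSide_of_mem hi] using this

theorem floorOn_add {x h : ι → ℝ} (hh : ∀ j ∈ J, ∃ z : ℤ, h j = z) :
    floorOn J (x + h) = floorOn J x + h := by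
  ext i
  by_cases hi : i ∈ J
  · obtain ⟨z, hz⟩ := hh i hi
    simp [floorOn_of_mem hi, hz]
  · simp [floorOn_of_notMem hi]

theorem measurable_floorOn : Measurable (floorOn J) := by
  refine measurable_pi_lambda _ fun i => ?_
  by_cases hi : i ∈ J
  · simp only [floorOn_of_mem hi]
    fun_prop
  · simp only [floorOn_of_notMem hi]
    fun_prop

theorem isBounded_gridCell {ε : ℝ} (hε : 0 < ε) (n : ι → ℤ) :
    Bornology.IsBounded (gridCell J ε n) := by
  rw [gridCell_eq_pi hε]
  exact Bornology.IsBounded.pi fun i => Metric.isBounded_Ico _ _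

variable [Fintype ι]

/-- Two points of a grid cell become close after changing one of them in the directions of `J`,
within a fibre of `floorOn J`. -/
theorem exists_floorOn_eq_dist_le {ε : ℝ} (hε : 0 < ε) {n : ι → ℤ} {x y : ι → ℝ}
    (hx : x ∈ gridCell J ε n) (hy : y ∈ gridCell J ε n) :
    ∃ z, floorOn J z = floorOn J y ∧ dist x z ≤ ε := by
  classical
  refine ⟨fun i => if i ∈ J then x i else y i, ?_, ?_⟩
  · ext i
    by_cases hi : i ∈ J
    · simp [floorOn_of_mem hi, hi, floor_eq_of_mem_gridCell hx hi, floor_eq_of_mem_gridCell hy hi]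
    · simp [floorOn_of_notMem hi, hi]
  · refine (dist_pi_le_iff hε.le).2 fun i => ?_
    by_cases hi : i ∈ J
    · simp [hi, hε.le]
    · have h1 := (mem_gridCell_iff hε).1 hx i
      have h2 := (mem_gridCell_iff hε).1 hy i
      rw [gridSide_of_notMem hi] at h1 h2
      simp only [hi, if_false, Real.dist_eq, abs_le]
      constructor <;> nlinarith [h1.1, h1.2, h2.1, h2.2]

theorem dist_floorOn_le (x : ι → ℝ) : dist x (floorOn J x) ≤ 1 := by
  refine (dist_pi_le_iff zero_le_one).2 fun i => ?_
  by_cases hi : i ∈ J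
  · rw [floorOn_of_mem hi, Real.dist_eq, Int.self_sub_floor, abs_of_nonneg (Int.fract_nonneg _)]
    exact (Int.fract_lt_one _).le
  · simp [floorOn_of_notMem hi]

theorem isBounded_preimage_floorOn {A : Set (ι → ℝ)} (hA : Bornology.IsBounded A) :
    Bornology.IsBounded (floorOn J ⁻¹' A) :=
  (hA.cthickening (δ := 1)).subset fun x hx =>
    Metric.mem_cthickening_of_dist_le _ _ _ _ hx (dist_floorOn_le x)

theorem measurableSet_gridCell {ε : ℝ} (hε : 0 < ε) (n : ι → ℤ) :
    MeasurableSet (gridCell J ε n) := by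
  rw [gridCell_eq_pi hε]
  exact MeasurableSet.univ_pi fun i => measurableSet_Ico

theorem volume_gridCell {ε : ℝ} (hε : 0 < ε) (n : ι → ℤ) :
    volume (gridCell J ε n) = ∏ i, ENNReal.ofReal (gridSide J ε i) := by
  rw [gridCell_eq_pi hε, Real.volume_pi_Ico]
  refine Finset.prod_congr rfl fun i _ => ?_
  congr 1
  ring

/-- A bounded set meets finitely many grid cells. -/
theorem finite_gridCell_inter_nonempty {ε : ℝ} (hε : 0 < ε) {A : Set (ι → ℝ)}
    (hA : Bornology.IsBounded A) : {n | (gridCell J ε n ∩ A).Nonempty}.Finite := by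
  classical
  obtain ⟨R, hR⟩ := hA.exists_norm_le
  refine (Set.finite_Icc (fun i => ⌊-R / gridSide J ε i⌋) (fun i => ⌊R / gridSide J ε i⌋)).subset ?_
  rintro n ⟨x, hx, hxA⟩
  have hn : gridIndex J ε x = n := hx
  have hxR : ∀ i, |x i| ≤ R := fun i => (norm_le_pi_norm x i).trans (hR x hxA)
  rw [← hn]
  refine ⟨fun i => Int.floor_le_floor ?_, fun i => Int.floor_le_floor ?_⟩
  · exact div_le_div_of_nonneg_right (abs_le.1 (hxR i)).1 (gridSide_pos hε i).le
  · exact div_le_div_of_nonneg_right (abs_le.1 (hxR i)).2 (gridSide_pos hε i).le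

/-- On a single cell the floors are constant, so `floorOn J` is the affine map `P x + v`. -/
theorem isHalfOpenPolyhedron_gridCell_inter {κ : Type} {ι : Type} {J : Set ι} [Finite κ] [Fintype ι]
    (b : Module.Basis κ ℝ (ι → ℝ)) {ε : ℝ} (hε : 0 < ε) (n : ι → ℤ) :
    IsHalfOpenPolyhedron (gridCell J ε n ∩ floorOn J ⁻¹' ZSpan.fundamentalDomain b) := by
  classical
  let P : (ι → ℝ) →ₗ[ℝ] (ι → ℝ) :=
    LinearMap.pi fun i => if i ∈ J then 0 else LinearMap.proj i
  let v : ι → ℝ := fun i => if i ∈ J then (n i : ℝ) else 0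
  have hfloor : ∀ x ∈ gridCell J ε n, floorOn J x = P x + v := by
    intro x hx
    ext i
    by_cases hi : i ∈ J
    · simp [P, v, hi, floorOn_of_mem hi, floor_eq_of_mem_gridCell hx hi]
    · simp [P, v, hi, floorOn_of_notMem hi]
  refine ⟨ι ⊕ κ, inferInstance, Sum.elim (fun i => LinearMap.proj i) (fun k => b.coord k ∘ₗ P),
    Sum.elim (fun i => n i * gridSide J ε i) (fun k => 0 - b.repr v k),
    Sum.elim (fun i => (n i + 1) * gridSide J ε i) (fun k => 1 - b.repr v k), ?_⟩
  ext x
  simp only [Set.mem_inter_iff, Set.mem_preimage, Set.mem_ofPred_eq, Sum.forall, Sum.elim_inl,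
    Sum.elim_inr, LinearMap.proj_apply, LinearMap.comp_apply, Module.Basis.coord_apply]
  rw [← mem_gridCell_iff hε]
  refine and_congr_right fun hx => ?_
  rw [hfloor x hx, ZSpan.mem_fundamentalDomain]
  refine forall_congr' fun k => ?_
  simp only [map_add, Finsupp.add_apply, Set.mem_Ico]
  exact and_congr sub_le_iff_le_add.symm lt_sub_iff_add_lt.symm

end Grid

/-! ### Fundamental domains adapted to rounding -/

theorem Set.Finite.frontier_biUnion_subset {X κ : Type*} [TopologicalSpace X] {s : Set κ}
    (hs : s.Finite) (f : κ → Set X) : frontier (⋃ i ∈ s, f i) ⊆ ⋃ i ∈ s, frontier (f i) := by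
  intro x hx
  rw [frontier, hs.closure_biUnion] at hx
  obtain ⟨i, hi, hxi⟩ := Set.mem_iUnion₂.1 hx.1
  refine Set.mem_iUnion₂.2 ⟨i, hi, hxi, fun h => hx.2 ?_⟩
  exact interior_mono (Set.subset_biUnion_of_mem (u := f) hi) h

/-- The set is a finite union of convex pieces, one per unit cell, and convex sets have null
frontier. -/
theorem measure_frontier_preimage_floorOn {ι κ : Type} {J : Set ι} [Fintype ι] [Finite κ]
    (b : Module.Basis κ ℝ (ι → ℝ)) (μ : Measure (ι → ℝ)) [μ.IsAddHaarMeasure] :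
    μ (frontier (floorOn J ⁻¹' ZSpan.fundamentalDomain b)) = 0 := by
  set A := floorOn J ⁻¹' ZSpan.fundamentalDomain b with hA
  have hfin : {n | (gridCell J 1 n ∩ A).Nonempty}.Finite := finite_gridCell_inter_nonempty
    one_pos (isBounded_preimage_floorOn (ZSpan.fundamentalDomain_isBounded b))
  have hcover : A = ⋃ n ∈ {n | (gridCell J 1 n ∩ A).Nonempty}, gridCell J 1 n ∩ A := by
    ext x
    simp only [Set.mem_iUnion, exists_prop]
    exact ⟨fun hx => ⟨gridIndex J 1 x, ⟨x, rfl, hx⟩, rfl, hx⟩, fun ⟨_, _, _, hx⟩ => hx⟩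
  rw [hcover]
  refine measure_mono_null (hfin.frontier_biUnion_subset _) ?_
  rw [measure_biUnion_null_iff hfin.countable]
  intro n _
  exact (isHalfOpenPolyhedron_gridCell_inter b one_pos n).convex.addHaar_frontier μ

/-- If the coordinates in `J` of all lattice vectors are integers, then rounding them down turns a
fundamental domain into another one. -/
theorem existsUnique_add_mem_preimage_floorOn {ι : Type} {J : Set ι} [Fintype ι]
    (L : Submodule ℤ (ι → ℝ)) [DiscreteTopology L] [IsZLattice ℝ L]
    (hL : ∀ x ∈ L, ∀ j ∈ J, ∃ z : ℤ, x j = z) (x : ι → ℝ) :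
    ∃! t : L, x + t ∈ floorOn J ⁻¹'
      ZSpan.fundamentalDomain ((IsZLattice.basis L).ofZLatticeBasis ℝ L) := by
  set b := (IsZLattice.basis L).ofZLatticeBasis ℝ L with hb
  have hspan : Submodule.span ℤ (Set.range b) = L := (IsZLattice.basis L).ofZLatticeBasis_span ℝ
  obtain ⟨v, hv, huniq⟩ := ZSpan.exist_unique_vadd_mem_fundamentalDomain b (floorOn J x)
  have hmem : ∀ t : L, x + t ∈ floorOn J ⁻¹' ZSpan.fundamentalDomain b ↔
      floorOn J x + t ∈ ZSpan.fundamentalDomain b := fun t => by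
    rw [Set.mem_preimage, floorOn_add (hL t t.2)]
  refine ⟨⟨v, hspan ▸ v.2⟩, (hmem _).2 ?_, fun t ht => ?_⟩
  · rw [add_comm]
    exact hv
  · have := huniq ⟨t, hspan.symm ▸ t.2⟩ (by
      have := (hmem t).1 ht
      rw [add_comm] at this
      exact this)
    exact Subtype.ext (congrArg (fun u : Submodule.span ℤ (Set.range b) => (u : ι → ℝ)) this)

theorem covolume_eq_measure_preimage_floorOn {ι : Type} {J : Set ι} [Fintype ι]
    (L : Submodule ℤ (ι → ℝ)) [DiscreteTopology L] [IsZLattice ℝ L]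
    (hL : ∀ x ∈ L, ∀ j ∈ J, ∃ z : ℤ, x j = z) (μ : Measure (ι → ℝ)) [μ.IsAddHaarMeasure] :
    ZLattice.covolume L μ = μ.real (floorOn J ⁻¹'
      ZSpan.fundamentalDomain ((IsZLattice.basis L).ofZLatticeBasis ℝ L)) := by
  refine ZLattice.covolume_eq_measure_fundamentalDomain L μ (IsAddFundamentalDomain.mk'
    (measurable_floorOn (ZSpan.fundamentalDomain_measurableSet _)).nullMeasurableSet fun x => ?_)
  simpa [Submodule.vadd_def, add_comm] using existsUnique_add_mem_preimage_floorOn L hL x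

/-! ### Comparing numbers of cells -/

theorem exists_measure_biUnion_gridCell {ι : Type*} [Fintype ι] (J : Set ι) (μ : Measure (ι → ℝ))
    [μ.IsAddHaarMeasure] : ∃ c : ℝ≥0∞, c ≠ 0 ∧ c ≠ ∞ ∧ ∀ ε > 0, ∀ I : Set (ι → ℤ),
      μ (⋃ n ∈ I, gridCell J ε n) = I.encard * (c * ∏ i, ENNReal.ofReal (gridSide J ε i)) := by
  refine ⟨μ.addHaarScalarFactor volume, ?_, ENNReal.coe_ne_top, fun ε hε I => ?_⟩
  · exact ENNReal.coe_ne_zero.2 (Measure.addHaarScalarFactor_pos_of_isAddHaarMeasure _ _).ne'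
  · have hcell : ∀ n, μ (gridCell J ε n) =
        μ.addHaarScalarFactor volume * ∏ i, ENNReal.ofReal (gridSide J ε i) := fun n => by
      conv_lhs => rw [Measure.isAddLeftInvariant_eq_smul μ volume]
      rw [Measure.smul_apply, volume_gridCell hε]
      rfl
    rw [measure_biUnion I.to_countable _ fun n _ => measurableSet_gridCell hε n]
    · simp only [hcell, ENNReal.tsum_const]
      rfl
    · exact fun m _ n _ hmn => Disjoint.preimage _ (Set.disjoint_singleton.2 hmn)

/-- If `A` has smaller measure than `B`, then the cells of a sufficiently fine grid that meet `A`
inject into the cells contained in `B` of a slightly coarser grid. -/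
theorem exists_injOn_gridCell {ι : Type*} [Fintype ι] (J : Set ι) (μ : Measure (ι → ℝ))
    [μ.IsAddHaarMeasure] (A B : Set (ι → ℝ)) (hA : Bornology.IsBounded (floorOn J ⁻¹' A))
    (hB : Bornology.IsBounded (floorOn J ⁻¹' B)) (hA0 : μ (frontier (floorOn J ⁻¹' A)) = 0)
    (hB0 : μ (frontier (floorOn J ⁻¹' B)) = 0) (hAB : μ (floorOn J ⁻¹' A) < μ (floorOn J ⁻¹' B)) :
    ∃ s > 1, ∃ ε > 0, ∃ φ : (ι → ℤ) → (ι → ℤ),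
      (∀ n, (gridCell J ε n ∩ floorOn J ⁻¹' A).Nonempty →
        gridCell J (s * ε) (φ n) ⊆ floorOn J ⁻¹' B) ∧
      Set.InjOn φ {n | (gridCell J ε n ∩ floorOn J ⁻¹' A).Nonempty} := by
  obtain ⟨c, hc0, hctop, hc⟩ := exists_measure_biUnion_gridCell J μ
  set A' := floorOn J ⁻¹' A with hA'
  set B' := floorOn J ⁻¹' B with hB'
  let k : ℝ → ℝ≥0∞ := fun s => ∏ i, ENNReal.ofReal (gridSide J s i)
  have hk0 : ∀ s > 0, k s ≠ 0 := fun s hs =>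
    Finset.prod_ne_zero_iff.2 fun i _ => (ENNReal.ofReal_pos.2 (gridSide_pos hs i)).ne'
  have hktop : ∀ s, k s ≠ ∞ := fun s => ENNReal.prod_ne_top fun i _ => ENNReal.ofReal_ne_top
  have hkmul : ∀ s > 0, ∀ ε > 0, k (s * ε) = k s * k ε := fun s hs ε hε => by
    simp only [k, gridSide_mul, ENNReal.ofReal_mul (gridSide_pos hs _).le, Finset.prod_mul_distrib]
  have hk1 : k 1 = 1 := by
    refine Finset.prod_eq_one fun i _ => ?_
    simp [gridSide]
  have hkcont : Continuous k := by
    have hside : ∀ i, Continuous fun s => gridSide J s i := fun i => by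
      by_cases hi : i ∈ J
      · simp only [gridSide_of_mem hi]
        fun_prop
      · simp only [gridSide_of_notMem hi]
        fun_prop
    have : k = fun s => ((∏ i, (gridSide J s i).toNNReal : NNReal) : ℝ≥0∞) := by
      ext s
      simp [k, ENNReal.ofReal]
    rw [this]
    exact ENNReal.continuous_coe.comp
      (continuous_finsetProd _ fun i _ => continuous_real_toNNReal.comp (hside i))
  -- Enlarging the cells by `s` multiplies their volume by `k s`, which tends to `1`; the gap
  -- between the measures absorbs this factor.
  obtain ⟨s, hs, hs1⟩ : ∃ s, k s * μ A' < μ B' ∧ 1 < s := by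
    have hlim : Filter.Tendsto (fun s => k s * μ A') (nhdsWithin 1 (Set.Ioi 1))
        (nhds (k 1 * μ A')) :=
      ENNReal.Tendsto.mul_const ((hkcont.tendsto 1).mono_left nhdsWithin_le_nhds)
        (Or.inr hA.measure_lt_top.ne)
    rw [hk1, one_mul] at hlim
    exact ((hlim.eventually (gt_mem_nhds hAB)).and self_mem_nhdsWithin).exists
  have hs0 : 0 < s := one_pos.trans hs1
  have hlimA : Filter.Tendsto (fun ε => μ (Metric.cthickening ε A')) (nhds 0) (nhds (μ A')) := by
    have hcl : μ (closure A') = μ A' := by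
      refine le_antisymm ?_ (measure_mono subset_closure)
      calc μ (closure A') ≤ μ (A' ∪ frontier A') := 
            measure_mono (closure_eq_self_union_frontier A').subset
        _ ≤ μ A' + μ (frontier A') := measure_union_le _ _
        _ = μ A' := by rw [hA0, add_zero]
    rw [← hcl]
    exact tendsto_measure_cthickening ⟨1, one_pos, hA.cthickening.measure_lt_top.ne⟩
  -- This bounds the part of `B'` lost to cells that stick out of `B'`; it vanishes in the limit
  -- because the frontier is null.
  have hlimB : Filter.Tendsto (fun ε => μ.restrict B' (Metric.cthickening (s * ε) B'ᶜ)) (nhds 0)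
      (nhds 0) := by
    have hcl : μ.restrict B' (closure B'ᶜ) = 0 := by
      rw [Measure.restrict_apply isClosed_closure.measurableSet]
      refine measure_mono_null (fun x hx => ?_) hB0
      rw [frontier_eq_closure_inter_closure]
      exact ⟨subset_closure hx.2, hx.1⟩
    have h := tendsto_measure_cthickening (μ := μ.restrict B') (s := B'ᶜ) ⟨1, one_pos, ?_⟩
    · rw [hcl] at h
      refine h.comp ?_
      have : Continuous fun ε : ℝ => s * ε := by fun_prop
      simpa using this.tendsto 0
    · refine ((measure_mono (Set.subset_univ _)).trans_lt ?_).ne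
      rw [Measure.restrict_apply_univ]
      exact hB.measure_lt_top
  obtain ⟨ε, hε, hε0⟩ : ∃ ε, k s * μ (Metric.cthickening ε A') +
      μ.restrict B' (Metric.cthickening (s * ε) B'ᶜ) < μ B' ∧ 0 < ε := by
    have hlim := (ENNReal.Tendsto.const_mul hlimA (Or.inr (hktop s))).add hlimB
    rw [add_zero] at hlim
    exact (((hlim.eventually (gt_mem_nhds hs)).filter_mono nhdsWithin_le_nhds).and
      (self_mem_nhdsWithin (s := Set.Ioi (0 : ℝ)))).exists
  have hsε : 0 < s * ε := mul_pos hs0 hε0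
  set I := {n | (gridCell J ε n ∩ A').Nonempty} with hI
  set I' := {n | gridCell J (s * ε) n ⊆ B'} with hI'
  -- Cells have length `1` along `J`, yet those meeting `A'` stay in its `ε`-thickening: `A'` is a
  -- union of fibres of `floorOn J`.
  have hIle : I.encard * (c * k ε) ≤ μ (Metric.cthickening ε A') := by
    rw [← hc ε hε0]
    refine measure_mono (Set.iUnion₂_subset fun n hn x hx => ?_)
    obtain ⟨y, hy, hyA⟩ := hn
    obtain ⟨z, hz, hxz⟩ := exists_floorOn_eq_dist_le hε0 hx hy
    refine Metric.mem_cthickening_of_dist_le x z _ _ ?_ hxz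
    rw [hA', Set.mem_preimage, hz]
    exact hyA
  have hIge : μ B' ≤ I'.encard * (c * k (s * ε)) +
      μ.restrict B' (Metric.cthickening (s * ε) B'ᶜ) := by
    rw [← hc _ hsε, Measure.restrict_apply Metric.isClosed_cthickening.measurableSet]
    refine (measure_mono fun x hx => ?_).trans (measure_union_le _ _)
    by_cases hxI : gridIndex J (s * ε) x ∈ I'
    · exact Or.inl (Set.mem_iUnion₂.2 ⟨_, hxI, rfl⟩)
    · refine Or.inr ⟨?_, hx⟩
      obtain ⟨y, hy, hyB⟩ := Set.not_subset.1 hxI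
      obtain ⟨z, hz, hxz⟩ := exists_floorOn_eq_dist_le (x := x) hsε rfl hy
      refine Metric.mem_cthickening_of_dist_le x z _ _ ?_ hxz
      rw [hB', Set.mem_compl_iff, Set.mem_preimage, hz]
      exact hyB
  have hcard : I.encard ≤ I'.encard := by
    have h1 : (I.encard : ℝ≥0∞) * (c * k (s * ε)) ≤ I'.encard * (c * k (s * ε)) := by
      have hfin : μ.restrict B' (Metric.cthickening (s * ε) B'ᶜ) ≠ ∞ :=
        (le_add_self.trans_lt (hε.trans hB.measure_lt_top)).ne
      rw [← ENNReal.add_le_add_iff_right hfin]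
      refine le_trans ?_ (hε.le.trans hIge)
      refine add_le_add ?_ le_rfl
      rw [hkmul s hs0 ε hε0]
      calc (I.encard : ℝ≥0∞) * (c * (k s * k ε)) = k s * (I.encard * (c * k ε)) := by ring
        _ ≤ _ := by gcongr
    rw [ENNReal.mul_le_mul_iff_left (mul_ne_zero hc0 (hk0 _ hsε))
      (ENNReal.mul_ne_top hctop (hktop _))] at h1
    exact ENat.toENNReal_le.1 h1
  obtain ⟨φ, hφ, hinj⟩ := (finite_gridCell_inter_nonempty hε0 hA).exists_injOn_of_encard_le hcard
  exact ⟨s, hs1, ε, hε0, φ, hφ, hinj⟩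

/-! ### Moving the cells and assembling the pieces -/

/-- A grid cell can be moved by a vector of a dense subgroup into any cell of a coarser grid. -/
theorem exists_add_mem_gridCell {ι : Type*} [Fintype ι] {J : Set ι} {L M : Submodule ℤ (ι → ℝ)}
    (hL : ∀ x ∈ L, ∀ j ∈ J, ∃ z : ℤ, x j = z) (hM : ∀ x ∈ M, ∀ j ∈ J, ∃ z : ℤ, x j = z)
    (hdense : ∀ x : ι → ℝ, (∀ j ∈ J, ∃ z : ℤ, x j = z) →
      x ∈ closure ((L ⊔ M : Submodule ℤ (ι → ℝ)) : Set (ι → ℝ)))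
    {s ε : ℝ} (hs : 1 < s) (hε : 0 < ε) (n n' : ι → ℤ) :
    ∃ l : L, ∃ m : M, ∀ x ∈ gridCell J ε n, x + l + m ∈ gridCell J (s * ε) n' := by
  classical
  -- Half the difference of the sides: the small cell is aimed at the centre of the large one, with
  -- margin `η` on both sides.
  set η := (s - 1) * ε / 2 with hη
  have hη0 : 0 < η := by
    have : 0 < s - 1 := by linarith
    positivity
  let v : ι → ℝ := fun i =>
    if i ∈ J then (n' i : ℝ) - n i else n' i * (s * ε) + η - n i * ε
  have hv : ∀ j ∈ J, ∃ z : ℤ, v j = z := fun j hj => ⟨n' j - n j, by simp [v, hj]⟩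
  -- The bound `1` forces the integer coordinates in `J` to agree exactly.
  obtain ⟨g, hg, hdist⟩ := Metric.mem_closure_iff.1 (hdense v hv) (min η 1) (by positivity)
  obtain ⟨l, hl, m, hm, rfl⟩ := Submodule.mem_sup.1 hg
  refine ⟨⟨l, hl⟩, ⟨m, hm⟩, fun x hx => ?_⟩
  rw [mem_gridCell_iff (by positivity)] at hx ⊢
  intro i
  have hi := (dist_le_pi_dist v (l + m) i).trans_lt hdist
  rw [Real.dist_eq, lt_min_iff, abs_lt] at hi
  have hxi := hx i
  simp only [Pi.add_apply] at hi ⊢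
  by_cases hJ : i ∈ J
  · obtain ⟨p, hp⟩ := hL l hl i hJ
    obtain ⟨q, hq⟩ := hM m hm i hJ
    have hz : n' i - n i - (p + q) = 0 := by
      rw [← Int.abs_lt_one_iff]
      have := hi.2
      simp only [v, hJ, if_true, hp, hq] at this
      exact_mod_cast this
    have hz' : (n' i : ℝ) - n i - (p + q) = 0 := by exact_mod_cast hz
    rw [gridSide_of_mem hJ] at hxi ⊢
    rw [hp, hq]
    constructor <;> linarith [hxi.1, hxi.2]
  · simp only [v, hJ, if_false] at hi
    rw [gridSide_of_notMem hJ] at hxi ⊢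
    have h2 : 2 * η = s * ε - ε := by rw [hη]; ring
    constructor <;> linarith [hxi.1, hxi.2, hi.1.1, hi.1.2]

/-- In coordinates in which `L + M` is dense in the vectors with integer coordinates in `J`, there
are finitely many half-open polyhedra whose union tiles exactly with `L` and packs exactly with `M`. -/
theorem exists_halfOpenPolyhedra {ι : Type} [Fintype ι] (J : Set ι) (μ : Measure (ι → ℝ))
    [μ.IsAddHaarMeasure] (L M : Submodule ℤ (ι → ℝ))
    [DiscreteTopology L] [IsZLattice ℝ L] [DiscreteTopology M] [IsZLattice ℝ M]
    (hL : ∀ x ∈ L, ∀ j ∈ J, ∃ z : ℤ, x j = z) (hM : ∀ x ∈ M, ∀ j ∈ J, ∃ z : ℤ, x j = z)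
    (hdense : ∀ x : ι → ℝ, (∀ j ∈ J, ∃ z : ℤ, x j = z) →
      x ∈ closure ((L ⊔ M : Submodule ℤ (ι → ℝ)) : Set (ι → ℝ)))
    (hvol : ZLattice.covolume L μ < ZLattice.covolume M μ) :
    ∃ S : Set (Set (ι → ℝ)), S.Finite ∧ (∀ p ∈ S, IsHalfOpenPolyhedron p) ∧
      (∀ p ∈ S, Bornology.IsBounded p) ∧ (∀ x : ι → ℝ, ∃! t : L, x + t ∈ ⋃₀ S) ∧
      ∀ x : ι → ℝ, ∀ t t' : M, x + t ∈ ⋃₀ S → x + t' ∈ ⋃₀ S → t = t' := by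
  rw [covolume_eq_measure_preimage_floorOn L hL μ, covolume_eq_measure_preimage_floorOn M hM μ]
    at hvol
  have htL := existsUnique_add_mem_preimage_floorOn L hL
  have htM := existsUnique_add_mem_preimage_floorOn M hM
  set bL := (IsZLattice.basis L).ofZLatticeBasis ℝ L
  set bM := (IsZLattice.basis M).ofZLatticeBasis ℝ M
  have hA := isBounded_preimage_floorOn (J := J) (ZSpan.fundamentalDomain_isBounded bL)
  have hB := isBounded_preimage_floorOn (J := J) (ZSpan.fundamentalDomain_isBounded bM)
  obtain ⟨s, hs, ε, hε, φ, hφ, hinj⟩ := exists_injOn_gridCell J μ _ _ hA hB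
    (measure_frontier_preimage_floorOn bL μ) (measure_frontier_preimage_floorOn bM μ)
    ((ENNReal.toReal_lt_toReal hA.measure_lt_top.ne hB.measure_lt_top.ne).1 hvol)
  choose l m hlm using fun n => exists_add_mem_gridCell hL hM hdense hs hε n (φ n)
  set A := floorOn J ⁻¹' ZSpan.fundamentalDomain bL
  set B := floorOn J ⁻¹' ZSpan.fundamentalDomain bM
  -- The part of `A` in cell `n`, translated by `l n`.
  let piece : (ι → ℤ) → Set (ι → ℝ) := fun n =>
    (fun x => x - (l n : ι → ℝ)) ⁻¹' (gridCell J ε n ∩ A)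
  have hmem : ∀ x, x ∈ ⋃₀ (piece '' {n | (gridCell J ε n ∩ A).Nonempty}) ↔
      ∃ n, x - (l n : ι → ℝ) ∈ gridCell J ε n ∧ x - (l n : ι → ℝ) ∈ A := fun x => by
    simp only [Set.sUnion_image, Set.mem_iUnion]
    exact ⟨fun ⟨n, _, hx⟩ => ⟨n, hx⟩, fun ⟨n, hx⟩ => ⟨n, ⟨_, hx⟩, hx⟩⟩
  refine ⟨piece '' {n | (gridCell J ε n ∩ A).Nonempty},
    (finite_gridCell_inter_nonempty hε hA).image _, ?_, ?_, fun x => ?_, fun x t t' ht ht' => ?_⟩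
  · rintro _ ⟨n, -, rfl⟩
    exact (isHalfOpenPolyhedron_gridCell_inter bL hε n).preimage_sub _
  · rintro _ ⟨n, -, rfl⟩
    have := ((isBounded_gridCell (J := J) hε n).subset
      (Set.inter_subset_left (t := A))).vadd (l n : ι → ℝ)
    refine this.subset fun x hx => ⟨x - l n, hx, by simp⟩
  · simp only [hmem]
    obtain ⟨t, ht, huniq⟩ := htL x
    refine ⟨t + l (gridIndex J ε (x + t)), ⟨gridIndex J ε (x + t), ?_⟩, ?_⟩
    · have : x + ((t + l (gridIndex J ε (x + t)) : L) : ι → ℝ) - l (gridIndex J ε (x + t)) =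
          x + t := by
        push_cast
        abel
      rw [this]
      exact ⟨rfl, ht⟩
    · rintro t' ⟨n, hn, hnA⟩
      have hsub : x + (t' : ι → ℝ) - l n = x + ((t' - l n : L) : ι → ℝ) := by
        push_cast
        abel
      rw [hsub] at hn hnA
      have h1 := huniq _ hnA
      have hn' : gridIndex J ε (x + ((t' - l n : L) : ι → ℝ)) = n := hn
      rw [← h1, hn', sub_add_cancel]
  · rw [hmem] at ht ht'
    obtain ⟨n, hn, hnA⟩ := ht
    obtain ⟨n', hn', hnA'⟩ := ht'
    -- Moving on by `m n` lands in cell `φ n` inside `B`. As `B` is a fundamental domain of `M`,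
    -- both moved points coincide; then `φ n = φ n'`, and injectivity gives `n = n'`.
    have key : ∀ (n : ι → ℤ) (t : M), x + (t : ι → ℝ) - l n ∈ gridCell J ε n →
        x + (t : ι → ℝ) - l n ∈ A →
        x + ((t + m n : M) : ι → ℝ) ∈ gridCell J (s * ε) (φ n) ∧
          x + ((t + m n : M) : ι → ℝ) ∈ B := by
      intro n t hn hnA
      have h := hlm n _ hn
      have he : x + (t : ι → ℝ) - l n + l n + m n = x + ((t + m n : M) : ι → ℝ) := by
        push_cast
        abel
      rw [he] at h
      exact ⟨h, hφ n ⟨_, hn, hnA⟩ h⟩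
    obtain ⟨h1, h2⟩ := key n t hn hnA
    obtain ⟨h1', h2'⟩ := key n' t' hn' hnA'
    have heq := (htM x).unique h2 h2'
    rw [heq] at h1
    have hφeq : φ n = φ n' := Eq.trans (Eq.symm h1) h1'
    have hnn : n = n' := hinj ⟨_, hn, hnA⟩ ⟨_, hn', hnA'⟩ hφeq
    rw [hnn] at heq
    exact add_right_cancel heq

/-! ### Transfer to coordinates adapted to the closure of `L + M` -/

theorem theorem2 (d : ℕ) (L M : Submodule ℤ (EuclideanSpace ℝ (Fin d)))
    [DiscreteTopology L] [IsZLattice ℝ L] [DiscreteTopology M] [IsZLattice ℝ M]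
    (hvol : ZLattice.covolume L < ZLattice.covolume M) :
    ∃ F : Set (EuclideanSpace ℝ (Fin d)),
      Bornology.IsBounded F ∧ MeasurableSet F ∧ IsFiniteUnionOfPolytopes F ∧
        TilesBy F (L : Set (EuclideanSpace ℝ (Fin d))) ∧
        PacksBy F (M : Set (EuclideanSpace ℝ (Fin d))) := by
  let H : AddSubgroup (EuclideanSpace ℝ (Fin d)) := (L ⊔ M).toAddSubgroup.topologicalClosure
  have hsub : ∀ x ∈ L ⊔ M, x ∈ H := fun x hx =>
    (L ⊔ M).toAddSubgroup.le_topologicalClosure hx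
  have hspan : Submodule.span ℝ (H : Set (EuclideanSpace ℝ (Fin d))) = ⊤ := by
    rw [eq_top_iff, ← IsZLattice.span_top (K := ℝ) (L := L)]
    exact Submodule.span_mono fun x hx => hsub x (le_sup_left (a := L) hx)
  obtain ⟨ι, _, J, b, hb⟩ := exists_basis_mem_iff_int_coords H
    (AddSubgroup.isClosed_topologicalClosure _) hspan
  let e : (ι → ℝ) ≃L[ℝ] EuclideanSpace ℝ (Fin d) := b.equivFunL.symm
  have he : ∀ x : ι → ℝ, e x ∈ H ↔ ∀ j ∈ J, ∃ z : ℤ, x j = z := fun x => by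
    have hrepr : ⇑(b.repr (e x)) = x := b.equivFun.apply_symm_apply x
    rw [hb, hrepr]
  -- Transporting Lebesgue measure along `e.symm` keeps both covolumes unchanged.
  let μ : Measure (ι → ℝ) := Measure.map e.symm volume
  have hμ : MeasurePreserving e μ volume :=
    MeasurePreserving.symm e.symm.toHomeomorph.toMeasurableEquiv
      ⟨e.symm.continuous.measurable, rfl⟩
  obtain ⟨S, hS, hpoly, hbd, htile, hpack⟩ := exists_halfOpenPolyhedra J μ
    (ZLattice.comap ℝ L e.toLinearMap) (ZLattice.comap ℝ M e.toLinearMap)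
    (fun x hx => (he x).1 (hsub _ (le_sup_left (a := L) hx)))
    (fun x hx => (he x).1 (hsub _ (le_sup_right (a := L) hx)))
    (fun x hx => by
      have h1 : e x ∈ closure ((L ⊔ M : Submodule ℤ _) : Set (EuclideanSpace ℝ (Fin d))) :=
        (he x).2 hx
      rw [← Set.mem_preimage, ← e.coe_toHomeomorph, e.toHomeomorph.preimage_closure] at h1
      refine closure_mono (fun y hy => ?_) h1
      obtain ⟨l, hl, m, hm, hlm⟩ := Submodule.mem_sup.1 hy
      refine Submodule.mem_sup.2 ⟨e.symm l, ?_, e.symm m, ?_, ?_⟩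
      · simpa [ZLattice.comap] using hl
      · simpa [ZLattice.comap] using hm
      · rw [← map_add, hlm]
        exact e.symm_apply_apply y)
    (by rwa [ZLattice.covolume_comap L volume μ hμ, ZLattice.covolume_comap M volume μ hμ])
  have hmem : ∀ x t : EuclideanSpace ℝ (Fin d), x + t ∈ ⋃₀ (Set.preimage e.symm '' S) ↔
      e.symm x + e.symm t ∈ ⋃₀ S := fun x t => by
    rw [← map_add]
    simp only [Set.sUnion_image, Set.mem_iUnion, Set.mem_sUnion, Set.mem_preimage, exists_prop]
  have hcomap : ∀ (N : Submodule ℤ (EuclideanSpace ℝ (Fin d))), ∀ t ∈ N,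
      e.symm t ∈ ZLattice.comap ℝ N e.toLinearMap := fun N t ht => by
    simpa [ZLattice.comap] using ht
  have : Countable (L : Set (EuclideanSpace ℝ (Fin d))) := inferInstanceAs (Countable L)
  have : Countable (M : Set (EuclideanSpace ℝ (Fin d))) := inferInstanceAs (Countable M)
  refine exists_polytopes_of_halfOpenPolyhedra _ _ (Set.preimage e.symm '' S) (hS.image _) ?_ ?_
    (fun x => ?_) fun x t t' ht ht' => ?_
  · rintro _ ⟨p, hp, rfl⟩
    exact (hpoly p hp).preimage e.symm.toLinearMap
  · rintro _ ⟨p, hp, rfl⟩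
    rw [← ContinuousLinearEquiv.image_eq_preimage_symm]
    exact e.lipschitz.isBounded_image (hbd p hp)
  · obtain ⟨t, ht, huniq⟩ := htile (e.symm x)
    refine ⟨⟨e t, t.2⟩, (hmem _ _).2 (by simpa using ht), fun t' ht' => ?_⟩
    have := huniq ⟨e.symm t', hcomap L _ t'.2⟩ ((hmem _ _).1 ht')
    exact Subtype.ext (by rw [← this]; simp)
  · have := hpack (e.symm x) ⟨e.symm t, hcomap M _ t.2⟩ ⟨e.symm t', hcomap M _ t'.2⟩
      ((hmem _ _).1 ht) ((hmem _ _).1 ht')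
    exact Subtype.ext (e.symm.injective (congrArg Subtype.val this))
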